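/- Let $\gamma,\beta\in\mathbb{R}$ with $|\gamma|<\pi/2$ and $\beta<1$, and let $\mathbb{D}=\{z\in\mathbb{C}:|z|<1\}$. Let $\mathcal{P}(0)$ be the class of all analytic functions $P$ in $\mathbb{D}$ with $P(0)=1$, $P'(0)=0$ and $$\operatorname{Re}\left(e^{i\gamma}P(z)\right)>\beta\cos\gamma\qquad(z\in\mathbb{D}).$$ For $z_0\in\mathbb{D}$ put $V_{\mathcal P}(z_0,0)=\left\{\int_0^{z_0}P(\zeta)\,d\zeta : P\in\mathcal{P}(0)\right\}$, and for $\theta\in\mathbb{R}$ let $$H_{e^{i\theta},0}(z)=1+2(1-\beta)e^{-i\gamma}\cos\gamma\,\frac{e^{i\theta}z^2}{1-e^{i\theta}z^2},\qquad z\in\mathbb{D}.$$ Let $z_0\in\mathbb{D}\setminus\{0\}$. Then the boundary $\partial V_{\mathcal P}(z_0,0)$ is the Jordan curve given by $$(-\pi,\pi]\ni\theta\mapsto\int_0^{z_0}H_{e^{i\theta},0}(\zeta)\,d\zeta=\left(1-2(1-\beta)e^{-i\gamma}\cos\gamma\right)z_0+e^{-i\gamma}(1-\beta)e^{-i\theta/2}\cos\gamma\,\log\left(\frac{1+e^{i\theta/2}z_0}{1-e^{i\theta/2}z_0}\right),$$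 where $\log$ is the principal branch; that is, this map is injective on $(-\pi,\pi]$, extends to a continuous map on $[-\pi,\pi]$ with equal values at $\pm\pi$, and its image is $\partial V_{\mathcal P}(z_0,0)$. Moreover, for every $\theta\in(-\pi,\pi]$ one has $H_{e^{i\theta},0}\in\mathcal{P}(0)$, and if $\int_0^{z_0}P(\zeta)\,d\zeta=\int_0^{z_0}H_{e^{i\theta},0}(\zeta)\,d\zeta$ for some $P\in\mathcal{P}(0)$, then $P=H_{e^{i\theta},0}$ in $\mathbb{D}$. -/

import Mathlib

noncomputable section

namespace VariabilityRegion

/-- The class `𝒫_{γ,β}`: functions `P` analytic in the open unit disk with `P(0) = 1` and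
`Re (e^{iγ} P(z)) > β cos γ` for all `z` in the disk.  A function on the disk is represented by a
function on `ℂ` of which only the values in the disk are constrained. -/
def classPGen (γ β : ℝ) : Set (ℂ → ℂ) :=
  {P | DifferentiableOn ℂ P (Metric.ball 0 1) ∧ P 0 = 1 ∧
    ∀ z ∈ Metric.ball (0 : ℂ) 1,
      β * Real.cos γ < (Complex.exp (Complex.I * (γ : ℂ)) * P z).re}

/-- The class `𝒫(λ)`: members of `𝒫_{γ,β}` with `P'(0) = 2 (1 - β) e^{-iγ} λ cos γ`. -/
def classP (γ β : ℝ) (lam : ℂ) : Set (ℂ → ℂ) :=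
  {P | P ∈ classPGen γ β ∧
    deriv P 0 = 2 * (1 - (β : ℂ)) * Complex.exp (-Complex.I * (γ : ℂ)) * lam
      * (Real.cos γ : ℂ)}

/-- The complex line integral `∫_0^{z₀} P(ζ) dζ`, taken along the segment `ζ = t z₀`,
`0 ≤ t ≤ 1` (for `P` analytic in the disk the path in the disk is immaterial). -/
def primitiveAt (P : ℂ → ℂ) (z₀ : ℂ) : ℂ :=
  ∫ t in (0 : ℝ)..1, P ((t : ℂ) * z₀) * z₀

/-- The region of variability `V_𝒫(z₀, λ)`. -/
def regionV (γ β : ℝ) (z₀ lam : ℂ) : Set ℂ :=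
  {w | ∃ P ∈ classP γ β lam, primitiveAt P z₀ = w}

/-- `δ(z, λ) = (z + λ) / (1 + conj λ * z)`. -/
def delta (z lam : ℂ) : ℂ :=
  (z + lam) / (1 + (starRingEnd ℂ) lam * z)

/-- The function `H_{a,λ}(z) = 1 + 2(1-β) e^{-iγ} cos γ * δ(az,λ) z / (1 - δ(az,λ) z)`. -/
def extremalH (γ β : ℝ) (a lam : ℂ) (z : ℂ) : ℂ :=
  1 + 2 * (1 - (β : ℂ)) * Complex.exp (-Complex.I * (γ : ℂ)) * (Real.cos γ : ℂ)
    * (delta (a * z) lam * z / (1 - delta (a * z) lam * z))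

/-- `J` is the Jordan curve (simple closed curve) given by `(-π, π] ∋ θ ↦ c θ`. -/
structure IsJordanCurveGivenBy (c : ℝ → ℂ) (J : Set ℂ) : Prop where
  continuousOn : ContinuousOn c (Set.Icc (-Real.pi) Real.pi)
  closed : c (-Real.pi) = c Real.pi
  injOn : Set.InjOn c (Set.Ioc (-Real.pi) Real.pi)
  image_eq : c '' Set.Ioc (-Real.pi) Real.pi = J

end VariabilityRegion

end

namespace VariabilityRegion

open Metric Set Filter Topology

/-! Write P = 1 + c·2ω/(1 - ω) with c = (1-β)e^{-iγ}cos γ. The class condition says that ω is a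
Schwarz function with a double zero at 0, so ω = a z² φ with |φ| ≤ 1 for any chosen |a| = 1; the
extremal function is the case φ = 1.

Support lines: the difference of the integrals of P and of H_a is c a z³ h(z), and it is compared
with c a z³ k(z), where z³ k is the integral of ζ²/(1 - aζ²)². The quotient q = h/k satisfies q + z
q' T = -2(1-φ)(1-az²)/(1-az²φ) with T = k(1-az²)². Both Re T > 0 and the sign of the right side are
elementary, and a Miller–Mocanu type maximum principle gives Re q ≤ 0, with q(z₀) = 0 only if φ = 1
(`re_div_nonpos_of_starlike`, `exists_support`). So each curve point lies on the frontier, its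
extremal function is unique, and the curve is injective.

Conversely, the region is convex with z₀ in its interior, so a ray from z₀ meets the frontier at
most once. The curve meets every such ray (`exists_mul_kernelMean_eq`), hence it covers the
frontier. -/

/-! ### Division by z and the equation (z³h)' = z²f -/

/-- A function holomorphic on the unit disk and vanishing at `0` is divisible by `z`. -/
theorem exists_eq_mul_of_map_zero {f : ℂ → ℂ} (hf : DifferentiableOn ℂ f (ball 0 1))
    (h0 : f 0 = 0) :
    ∃ g : ℂ → ℂ, DifferentiableOn ℂ g (ball 0 1) ∧ ∀ z, f z = z * g z := by
  refine ⟨dslope f 0, (Complex.differentiableOn_dslope (ball_mem_nhds 0 one_pos)).2 hf, fun z => ?_⟩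
  have := sub_smul_dslope f 0 z
  simp only [sub_zero, smul_eq_mul, h0] at this
  exact this.symm

theorem eq_zero_of_eq_off_zero {f g : ℂ → ℂ} (hf : ContinuousOn f (ball 0 1))
    (hg : ContinuousOn g (ball 0 1)) (h : ∀ z ∈ ball (0 : ℂ) 1, z ≠ 0 → f z = g z) :
    ∀ z ∈ ball (0 : ℂ) 1, f z = g z := by
  intro z hz
  by_cases hz0 : z = 0
  · subst hz0
    have hn : ball (0 : ℂ) 1 ∈ 𝓝 0 := ball_mem_nhds 0 one_pos
    have h1 : f =ᶠ[𝓝[≠] 0] g := by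
      filter_upwards [mem_nhdsWithin_of_mem_nhds hn, self_mem_nhdsWithin] with w hw hw0
      exact h w hw hw0
    have h2 := ((hf.continuousAt hn).eventuallyEq_nhds_iff_eventuallyEq_nhdsNE
      (hg.continuousAt hn)).1 h1
    exact h2.eq_of_nhds
  · exact h z hz hz0

/-- For `f` holomorphic on the unit disk the equation `(z³ h)' = z² f` has a holomorphic
solution. -/
theorem exists_three_mul_add_mul_deriv_eq {f : ℂ → ℂ} (hf : DifferentiableOn ℂ f (ball 0 1)) :
    ∃ h : ℂ → ℂ, DifferentiableOn ℂ h (ball 0 1) ∧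
      ∀ z ∈ ball (0 : ℂ) 1, 3 * h z + z * deriv h z = f z := by
  have h0m : (0 : ℂ) ∈ ball (0 : ℂ) 1 := mem_ball_self one_pos
  have hnhds : ∀ z ∈ ball (0 : ℂ) 1, ball (0 : ℂ) 1 ∈ 𝓝 z := fun z hz => isOpen_ball.mem_nhds hz
  have hd : DifferentiableOn ℂ (fun z => z ^ 2 * f z) (ball 0 1) := by fun_prop
  obtain ⟨F, hF0, hF⟩ := hd.isExactOn_ball.with_val_at 0 0
  have hFd : DifferentiableOn ℂ F (ball 0 1) := fun z hz =>
    (hF z hz).differentiableAt.differentiableWithinAt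
  -- F is divided by z three times. After each of the first two divisions, the differential equation
  -- evaluated at 0 shows that the quotient vanishes there, which permits the next one.
  obtain ⟨g₁, hg₁, e₁⟩ := exists_eq_mul_of_map_zero hFd hF0
  have hg₁d : ∀ z ∈ ball (0 : ℂ) 1, HasDerivAt g₁ (deriv g₁ z) z := fun z hz =>
    (hg₁.differentiableAt (hnhds z hz)).hasDerivAt
  have d₁ : ∀ z ∈ ball (0 : ℂ) 1, 1 * g₁ z + z * deriv g₁ z = z ^ 2 * f z := fun z hz =>
    ((hasDerivAt_id z).mul (hg₁d z hz)).unique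
      ((hF z hz).congr_of_eventuallyEq (Eventually.of_forall fun w => (e₁ w).symm))
  have z₁ : g₁ 0 = 0 := by simpa using d₁ 0 h0m
  obtain ⟨g₂, hg₂, e₂⟩ := exists_eq_mul_of_map_zero hg₁ z₁
  have hg₂d : ∀ z ∈ ball (0 : ℂ) 1, HasDerivAt g₂ (deriv g₂ z) z := fun z hz =>
    (hg₂.differentiableAt (hnhds z hz)).hasDerivAt
  have d₂ : ∀ z ∈ ball (0 : ℂ) 1, 2 * g₂ z + z * deriv g₂ z = z * f z := by
    refine eq_zero_of_eq_off_zero ?_ ?_ ?_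
    · have := (hg₂.deriv isOpen_ball).continuousOn
      have := hg₂.continuousOn
      fun_prop
    · have := hf.continuousOn
      fun_prop
    · intro z hz hz0
      have h1 : deriv g₁ z = 1 * g₂ z + z * deriv g₂ z := (hg₁d z hz).unique
        (((hasDerivAt_id z).mul (hg₂d z hz)).congr_of_eventuallyEq (Eventually.of_forall e₂))
      have h2 := d₁ z hz
      rw [h1, e₂] at h2
      apply mul_left_cancel₀ hz0
      linear_combination h2
  have z₂ : g₂ 0 = 0 := by simpa using d₂ 0 h0m
  obtain ⟨h, hh, e₃⟩ := exists_eq_mul_of_map_zero hg₂ z₂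
  refine ⟨h, hh, eq_zero_of_eq_off_zero ?_ hf.continuousOn ?_⟩
  · have := (hh.deriv isOpen_ball).continuousOn
    have := hh.continuousOn
    fun_prop
  · intro z hz hz0
    have h1 : deriv g₂ z = 1 * h z + z * deriv h z := (hg₂d z hz).unique
      (((hasDerivAt_id z).mul (hh.differentiableAt (hnhds z hz)).hasDerivAt).congr_of_eventuallyEq
        (Eventually.of_forall e₃))
    have h2 := d₂ z hz
    rw [h1, e₃] at h2
    apply mul_left_cancel₀ hz0
    linear_combination h2

/-! ### Integrals along a segment -/

theorem ofReal_mul_mem_ball {z₀ : ℂ} (hz₀ : z₀ ∈ ball (0 : ℂ) 1) {t : ℝ} (ht : t ∈ Icc (0 : ℝ) 1) :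
    (t : ℂ) * z₀ ∈ ball (0 : ℂ) 1 := by
  rw [mem_ball_zero_iff] at hz₀ ⊢
  rw [norm_mul, Complex.norm_real, Real.norm_eq_abs, abs_of_nonneg ht.1]
  exact (mul_le_of_le_one_left (norm_nonneg _) ht.2).trans_lt hz₀

theorem continuousOn_segment {f : ℂ → ℂ} (hf : ContinuousOn f (ball 0 1))
    {z₀ : ℂ} (hz₀ : z₀ ∈ ball (0 : ℂ) 1) :
    ContinuousOn (fun t : ℝ => f ((t : ℂ) * z₀) * z₀) (uIcc 0 1) := by
  refine ContinuousOn.mul (hf.comp (by fun_prop) fun t ht => ?_) continuousOn_const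
  rw [uIcc_of_le zero_le_one] at ht
  exact ofReal_mul_mem_ball hz₀ ht

theorem primitiveAt_congr {f g : ℂ → ℂ} (h : EqOn f g (ball 0 1)) {z₀ : ℂ}
    (hz₀ : z₀ ∈ ball (0 : ℂ) 1) : primitiveAt f z₀ = primitiveAt g z₀ := by
  refine intervalIntegral.integral_congr fun t ht => ?_
  rw [uIcc_of_le zero_le_one] at ht
  simp only [h (ofReal_mul_mem_ball hz₀ ht)]

theorem primitiveAt_add {f g : ℂ → ℂ} (hf : ContinuousOn f (ball 0 1))
    (hg : ContinuousOn g (ball 0 1)) {z₀ : ℂ} (hz₀ : z₀ ∈ ball (0 : ℂ) 1) :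
    primitiveAt (fun z => f z + g z) z₀ = primitiveAt f z₀ + primitiveAt g z₀ := by
  simp only [primitiveAt, add_mul]
  exact intervalIntegral.integral_add (continuousOn_segment hf hz₀).intervalIntegrable
    (continuousOn_segment hg hz₀).intervalIntegrable

theorem primitiveAt_const_mul (c : ℂ) (f : ℂ → ℂ) (z₀ : ℂ) :
    primitiveAt (fun z => c * f z) z₀ = c * primitiveAt f z₀ := by
  simp only [primitiveAt, mul_assoc]
  exact intervalIntegral.integral_const_mul _ _

theorem primitiveAt_eq_sub {f F : ℂ → ℂ} (hf : ContinuousOn f (ball 0 1))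
    (hF : ∀ z ∈ ball (0 : ℂ) 1, HasDerivAt F (f z) z) {z₀ : ℂ} (hz₀ : z₀ ∈ ball (0 : ℂ) 1) :
    primitiveAt f z₀ = F z₀ - F 0 := by
  have h := intervalIntegral.integral_eq_sub_of_hasDerivAt (f := fun t : ℝ => F ((t : ℂ) * z₀))
    (f' := fun t : ℝ => f ((t : ℂ) * z₀) * z₀) (a := 0) (b := 1) (fun t ht => ?_)
    (continuousOn_segment hf hz₀).intervalIntegrable
  · simpa [primitiveAt] using h
  · rw [uIcc_of_le zero_le_one] at ht
    have h1 : HasDerivAt (fun t : ℝ => (t : ℂ) * z₀) z₀ t := by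
      simpa using (Complex.ofRealCLM.hasDerivAt (x := t)).mul_const z₀
    exact (hF _ (ofReal_mul_mem_ball hz₀ ht)).comp_of_eq t h1 rfl

/-- The integral along a segment of `z² f`, in terms of the solution of `(z³ h)' = z² f`. -/
theorem primitiveAt_sq_mul {f h : ℂ → ℂ} (hf : DifferentiableOn ℂ f (ball 0 1))
    (hh : DifferentiableOn ℂ h (ball 0 1))
    (hfh : ∀ z ∈ ball (0 : ℂ) 1, 3 * h z + z * deriv h z = f z)
    {z₀ : ℂ} (hz₀ : z₀ ∈ ball (0 : ℂ) 1) :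
    primitiveAt (fun z => z ^ 2 * f z) z₀ = z₀ ^ 3 * h z₀ := by
  have hc := hf.continuousOn
  rw [primitiveAt_eq_sub (F := fun z => z ^ 3 * h z) (by fun_prop) (fun z hz => ?_) hz₀]
  · simp
  · have h1 := ((hasDerivAt_id z).pow 3).mul
      (hh.differentiableAt (isOpen_ball.mem_nhds hz)).hasDerivAt
    refine h1.congr_deriv ?_
    simp only [id, ← hfh z hz, Pi.pow_apply]
    push_cast
    ring

/-! ### A maximum principle for q + z q' T -/

/-- At a maximum point `w` of `Re q` on a closed disk about `0`, `w q'(w)` is real and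
nonnegative. -/
theorem mul_deriv_of_isMaxOn_re {q : ℂ → ℂ} {w : ℂ} (hq : DifferentiableAt ℂ q w)
    (hm : ∀ z, ‖z‖ ≤ ‖w‖ → (q z).re ≤ (q w).re) :
    0 ≤ (w * deriv q w).re ∧ (w * deriv q w).im = 0 := by
  have key : ∀ (c : ℝ → ℂ) (c' : ℂ) (t₀ : ℝ), c t₀ = w → HasDerivAt c c' t₀ →
      HasDerivAt (fun t => (q (c t)).re) (deriv q w * c').re t₀ := by
    intro c c' t₀ h0 hc
    have hq' : HasDerivAt q (deriv q w) (c t₀) := h0 ▸ hq.hasDerivAt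
    have := hq'.comp_of_eq t₀ hc rfl
    exact (Complex.reCLM.hasFDerivAt.comp_hasDerivAt t₀ this)
  constructor
  -- Radial direction: the bound on Re q holds only inside the disk, so just the left derivative at
  -- t = 1 is controlled, which gives a sign.
  · have h1 := key (fun t : ℝ => (t : ℂ) * w) w 1 (by simp)
      (by simpa using (Complex.ofRealCLM.hasDerivAt (x := (1 : ℝ))).mul_const w)
    rw [mul_comm w]
    by_contra hneg
    push Not at hneg
    have h2 := h1.hasDerivWithinAt (s := Iic 1)
    have h3 := hasDerivWithinAt_iff_tendsto_slope.1 h2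
    have h4 : ∀ᶠ t in 𝓝[Iic 1 \ {1}] (1 : ℝ), 0 ≤ slope (fun t : ℝ => (q (t * w)).re) 1 t := by
      have : Ioi (0 : ℝ) ∈ 𝓝 (1 : ℝ) := Ioi_mem_nhds one_pos
      filter_upwards [mem_nhdsWithin_of_mem_nhds this, self_mem_nhdsWithin] with t ht ht1
      rw [slope_def_field]
      have ht2 : t ≤ 1 := ht1.1
      have : ‖(t : ℂ) * w‖ ≤ ‖w‖ := by
        rw [norm_mul, Complex.norm_real, Real.norm_eq_abs, abs_of_pos ht]
        exact mul_le_of_le_one_left (norm_nonneg _) ht2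
      have h5 := hm _ this
      apply div_nonneg_of_nonpos
      · simpa using h5
      · linarith
    have hne : (𝓝[Iic 1 \ {1}] (1 : ℝ)).NeBot := by
      rw [Iic_sdiff_right]; infer_instance
    exact absurd (ge_of_tendsto h3 h4) (not_le.2 hneg)
  -- Rotation stays on the circle, so t = 0 is a two-sided maximum and the derivative -Im (w q'(w))
  -- vanishes.
  · have hc : HasDerivAt (fun t : ℝ => w * Complex.exp ((t : ℂ) * Complex.I)) (w * Complex.I) 0 := by
      have := (((Complex.ofRealCLM.hasDerivAt (x := (0 : ℝ))).mul_const Complex.I).cexp).const_mul w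
      simpa using this
    have h1 := key _ _ 0 (by simp) hc
    have h2 : IsLocalMax (fun t : ℝ => (q (w * Complex.exp ((t : ℂ) * Complex.I))).re) 0 := by
      refine Eventually.of_forall fun t => ?_
      have := hm (w * Complex.exp ((t : ℂ) * Complex.I)) (by
        rw [norm_mul, Complex.norm_exp_ofReal_mul_I, mul_one])
      simpa using this
    have h3 := h2.hasDerivAt_eq_zero h1
    simp only [Complex.mul_re, Complex.mul_im, Complex.I_re, Complex.I_im] at h3 ⊢
    linarith

/-- At a maximum point w of Re q on the closed disk of radius ‖z‖, the number w q'(w) is real and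
nonnegative, so adding w q'(w) T(w) cannot lower the real part. An upper bound for Re (q + z q' T)
thus passes to Re q. -/
theorem exists_re_le_re_add_mul_deriv {q T : ℂ → ℂ} (hq : DifferentiableOn ℂ q (ball 0 1))
    (hT : ∀ z ∈ ball (0 : ℂ) 1, 0 ≤ (T z).re) {z : ℂ} (hz : z ∈ ball (0 : ℂ) 1) :
    ∃ w ∈ ball (0 : ℂ) 1, (q z).re ≤ (q w + w * deriv q w * T w).re := by
  have hz1 : ‖z‖ < 1 := by simpa using hz
  have hsub : closedBall (0 : ℂ) ‖z‖ ⊆ ball 0 1 := closedBall_subset_ball hz1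
  obtain ⟨w, hw, hmax⟩ := (isCompact_closedBall (0 : ℂ) ‖z‖).exists_isMaxOn
    ⟨z, by simp⟩ (f := fun x => (q x).re)
    (Complex.continuous_re.comp_continuousOn (hq.continuousOn.mono hsub))
  have hw1 := hsub hw
  have hwz : ‖w‖ ≤ ‖z‖ := by simpa using hw
  obtain ⟨h1, h2⟩ := mul_deriv_of_isMaxOn_re (hq.differentiableAt (isOpen_ball.mem_nhds hw1))
    (fun x hx => hmax (show x ∈ closedBall (0 : ℂ) ‖z‖ by simpa using hx.trans hwz))
  refine ⟨w, hw1, (hmax (show z ∈ closedBall (0 : ℂ) ‖z‖ by simp)).trans ?_⟩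
  rw [Complex.add_re, Complex.mul_re _ (T w), h2]
  have := mul_nonneg h1 (hT w hw1)
  simp only at this ⊢
  linarith

/-! ### Half-plane inequalities -/

theorem norm_mul_sq_lt_one {a z : ℂ} (ha : ‖a‖ ≤ 1) (hz : z ∈ ball (0 : ℂ) 1) :
    ‖a * z ^ 2‖ < 1 := by
  rw [mem_ball_zero_iff] at hz
  rw [norm_mul, norm_pow]
  have := norm_nonneg z
  nlinarith [norm_nonneg a, mul_le_mul_of_nonneg_right ha (sq_nonneg ‖z‖)]

theorem one_sub_ne_zero {u : ℂ} (hu : ‖u‖ < 1) : 1 - u ≠ 0 := by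
  intro h
  rw [← sub_eq_zero.1 h] at hu
  simp at hu

theorem normSq_le_one {u : ℂ} (hu : ‖u‖ ≤ 1) : u.re * u.re + u.im * u.im ≤ 1 := by
  rw [← Complex.normSq_apply, Complex.normSq_eq_norm_sq]
  exact pow_le_one₀ (norm_nonneg _) hu

theorem normSq_lt_one {u : ℂ} (hu : ‖u‖ < 1) : u.re * u.re + u.im * u.im < 1 := by
  rw [← Complex.normSq_apply, Complex.normSq_eq_norm_sq]
  exact pow_lt_one₀ (norm_nonneg _) hu two_ne_zero

theorem re_div_nonneg_of {x y : ℂ} (h : 0 ≤ x.re * y.re + x.im * y.im) : 0 ≤ (x / y).re := by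
  rw [Complex.div_re, ← add_div]
  exact div_nonneg h (Complex.normSq_nonneg _)

theorem re_div_pos_of {x y : ℂ} (h : 0 < x.re * y.re + x.im * y.im) : 0 < (x / y).re := by
  have hy : y ≠ 0 := by rintro rfl; simp at h
  rw [Complex.div_re, ← add_div]
  exact div_pos h (Complex.normSq_pos.2 hy)

theorem three_add_ne_zero {u : ℂ} (hu : ‖u‖ < 1) : 3 + u ≠ 0 := by
  intro h
  rw [← neg_eq_of_add_eq_zero_right h] at hu
  norm_num at hu

theorem re_one_sub_div_three_add_pos {u : ℂ} (hu : ‖u‖ < 1) : 0 < ((1 - u) / (3 + u)).re := by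
  have h := normSq_lt_one hu
  apply re_div_pos_of
  simp
  nlinarith [sq_nonneg (u.re+1), mul_self_nonneg u.im]

/-- Off the degenerate case φ = 1 the reciprocal is 1/(1-u) + 1/(1-φ) - 1, and the first two terms
have real part at least 1/2. The proof uses this with denominators cleared. -/
theorem re_one_sub_mul_one_sub_div_nonneg {u φ : ℂ} (hu : ‖u‖ < 1) (hφ : ‖φ‖ ≤ 1) :
    0 ≤ ((1 - φ) * (1 - u) / (1 - u * φ)).re := by
  have h := normSq_lt_one hu
  have h' := normSq_le_one hφ
  apply re_div_nonneg_of
  simp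
  have h1 : 0 ≤ ((1 - u.re) ^ 2 + u.im ^ 2) * (1 - (φ.re * φ.re + φ.im * φ.im)) :=
    mul_nonneg (by positivity) (by linarith)
  have h2 : 0 ≤ ((1 - φ.re) ^ 2 + φ.im ^ 2) * (1 - (u.re * u.re + u.im * u.im)) :=
    mul_nonneg (by positivity) (by linarith)
  linarith

/-! ### The starlike comparison function and the support inequality -/

/-- The function `z ↦ ∫₀^z a ζ² / (1 - a ζ²)² dζ = a z³ k(z)` is starlike (of order three). -/
theorem exists_starlike {a : ℂ} (ha : ‖a‖ ≤ 1) :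
    ∃ k : ℂ → ℂ, DifferentiableOn ℂ k (ball 0 1) ∧
      (∀ z ∈ ball (0 : ℂ) 1, 3 * k z + z * deriv k z = 1 / (1 - a * z ^ 2) ^ 2) ∧
      ∀ z ∈ ball (0 : ℂ) 1, 0 < (k z * (1 - a * z ^ 2) ^ 2).re := by
  have hne : ∀ z ∈ ball (0 : ℂ) 1, 1 - a * z ^ 2 ≠ 0 := fun z hz =>
    one_sub_ne_zero (norm_mul_sq_lt_one ha hz)
  have hd : DifferentiableOn ℂ (fun z => 1 / (1 - a * z ^ 2) ^ 2) (ball 0 1) := by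
    refine DifferentiableOn.div (by fun_prop) (by fun_prop) fun z hz => pow_ne_zero _ (hne z hz)
  obtain ⟨k, hk, hke⟩ := exists_three_mul_add_mul_deriv_eq hd
  refine ⟨k, hk, hke, fun z hz => ?_⟩
  -- With p = k(1-az²)² and T = (1-az²)/(3+az²), the equation for k becomes p + z p' T = T. The sign
  -- turns the lower bound for Re p into an upper bound for Re q.
  set q : ℂ → ℂ := fun z => -(k z * (1 - a * z ^ 2) ^ 2) with hq
  have hqd : DifferentiableOn ℂ q (ball 0 1) := by fun_prop
  obtain ⟨w, hw, hle⟩ := exists_re_le_re_add_mul_deriv hqd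
    (T := fun z => (1 - a * z ^ 2) / (3 + a * z ^ 2))
    (fun z hz => (re_one_sub_div_three_add_pos (norm_mul_sq_lt_one ha hz)).le) hz
  have hu := norm_mul_sq_lt_one ha hw
  have hq' : HasDerivAt q (-(deriv k w * (1 - a * w ^ 2) ^ 2
      + k w * (2 * (1 - a * w ^ 2) * (-(a * (2 * w)))))) w := by
    have h1 : HasDerivAt (fun z => 1 - a * z ^ 2) (-(a * (2 * w))) w := by
      simpa using (((hasDerivAt_id w).pow 2).const_mul a).const_sub 1
    have h2 := ((hk.differentiableAt (isOpen_ball.mem_nhds hw)).hasDerivAt.mul (h1.pow 2)).neg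
    refine HasDerivAt.congr_deriv (f := q) h2 ?_
    simp
  have h3 := three_add_ne_zero hu
  have e : q w + w * deriv q w * ((1 - a * w ^ 2) / (3 + a * w ^ 2))
      = -((1 - a * w ^ 2) / (3 + a * w ^ 2)) := by
    have hkw := hke w hw
    rw [eq_div_iff (pow_ne_zero _ (hne w hw))] at hkw
    rw [hq'.deriv, hq]
    field_simp
    linear_combination (-(1 - a * w ^ 2)) * hkw
  rw [e] at hle
  have := re_one_sub_div_three_add_pos hu
  simp only [hq, Complex.neg_re] at hle
  linarith

/-- The support inequality for the normalised problem, with its equality case. -/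
theorem re_div_nonpos_of_starlike {a : ℂ} (ha : ‖a‖ ≤ 1) {k h φ : ℂ → ℂ}
    (hk : DifferentiableOn ℂ k (ball 0 1))
    (hke : ∀ z ∈ ball (0 : ℂ) 1, 3 * k z + z * deriv k z = 1 / (1 - a * z ^ 2) ^ 2)
    (hkpos : ∀ z ∈ ball (0 : ℂ) 1, 0 < (k z * (1 - a * z ^ 2) ^ 2).re)
    (hφ1 : ∀ z ∈ ball (0 : ℂ) 1, ‖φ z‖ ≤ 1)
    (hh : DifferentiableOn ℂ h (ball 0 1))
    (hhe : ∀ z ∈ ball (0 : ℂ) 1, 3 * h z + z * deriv h z =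
      2 * (φ z - 1) / ((1 - a * z ^ 2 * φ z) * (1 - a * z ^ 2))) :
    ∀ z₀ ∈ ball (0 : ℂ) 1, (h z₀ / k z₀).re ≤ 0 ∧
      (h z₀ = 0 → ∀ z ∈ ball (0 : ℂ) 1, φ z = 1) := by
  have hne : ∀ z ∈ ball (0 : ℂ) 1, 1 - a * z ^ 2 ≠ 0 := fun z hz =>
    one_sub_ne_zero (norm_mul_sq_lt_one ha hz)
  have hneφ : ∀ z ∈ ball (0 : ℂ) 1, 1 - a * z ^ 2 * φ z ≠ 0 := fun z hz =>
    one_sub_ne_zero (by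
      rw [norm_mul]
      exact (mul_le_of_le_one_right (norm_nonneg _) (hφ1 z hz)).trans_lt
        (norm_mul_sq_lt_one ha hz))
  have hk0 : ∀ z ∈ ball (0 : ℂ) 1, k z ≠ 0 := fun z hz h0 => by
    have := hkpos z hz
    simp [h0] at this
  have hqd : DifferentiableOn ℂ (fun z => h z / k z) (ball 0 1) := hh.div hk hk0
  have hle : ∀ z ∈ ball (0 : ℂ) 1, (h z / k z).re ≤ 0 := by
    intro z hz
    obtain ⟨w, hw, hle⟩ := exists_re_le_re_add_mul_deriv hqd
      (T := fun z => k z * (1 - a * z ^ 2) ^ 2) (fun z hz => (hkpos z hz).le) hz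
    refine hle.trans ?_
    have hw' := isOpen_ball.mem_nhds hw
    have hdiv := (hh.differentiableAt hw').hasDerivAt.div (hk.differentiableAt hw').hasDerivAt
      (hk0 w hw)
    -- Insert h = qk into the equation for h and divide by 3k + zk' = 1/(1-az²)².
    have e : h w / k w + w * deriv (fun z => h z / k z) w * (k w * (1 - a * w ^ 2) ^ 2)
        = -(2 * ((1 - φ w) * (1 - a * w ^ 2) / (1 - a * w ^ 2 * φ w))) := by
      have h1 := hke w hw
      have h2 := hhe w hw
      have n1 := hne w hw
      have n2 := hneφ w hw
      have n3 := hk0 w hw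
      have h1' : w * deriv k w = 1 / (1 - a * w ^ 2) ^ 2 - 3 * k w := by rw [← h1]; ring
      have h2' : w * deriv h w = 2 * (φ w - 1) / ((1 - a * w ^ 2 * φ w) * (1 - a * w ^ 2))
        - 3 * h w := by rw [← h2]; ring
      have h3 : w * deriv (fun z => h z / k z) w
          = (w * deriv h w * k w - h w * (w * deriv k w)) / k w ^ 2 := by
        rw [show deriv (fun z => h z / k z) w = _ from hdiv.deriv]; ring
      rw [h3, h1', h2']
      field_simp
      ring
    rw [e, Complex.neg_re, two_mul, Complex.add_re]
    have := re_one_sub_mul_one_sub_div_nonneg (norm_mul_sq_lt_one ha hw) (hφ1 w hw)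
    linarith
  refine fun z₀ hz₀ => ⟨hle z₀ hz₀, fun h0 z hz => ?_⟩
  -- If h(z₀) = 0 then Re (h/k) attains its maximum 0 at an interior point. Exponentiating makes
  -- this a maximum of the modulus, so the quotient is constant.
  have hexp : EqOn (fun z => Complex.exp (h z / k z)) (Function.const ℂ 1) (ball 0 1) := by
    have := Complex.eqOn_of_isPreconnected_of_isMaxOn_norm (f := fun z => Complex.exp (h z / k z))
      (convex_ball (0 : ℂ) 1).isPreconnected isOpen_ball hqd.cexp hz₀ (fun z hz => by
        simpa [Complex.norm_exp, h0] using hle z hz)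
    simpa [h0] using this
  have hq0 : ∀ w ∈ ball (0 : ℂ) 1, deriv (fun z => h z / k z) w = 0 := by
    intro w hw
    have h1 := (hqd.differentiableAt (isOpen_ball.mem_nhds hw)).hasDerivAt.cexp
    have h2 := h1.congr_of_eventuallyEq
      ((hexp.eventuallyEq_of_mem (isOpen_ball.mem_nhds hw)).symm)
    have h3 := h2.unique (hasDerivAt_const w (1 : ℂ))
    exact (mul_eq_zero.1 h3).resolve_left (Complex.exp_ne_zero _)
  have hconst : ∀ w ∈ ball (0 : ℂ) 1, h w = 0 := by
    intro w hw
    have := isOpen_ball.is_const_of_deriv_eq_zero (convex_ball (0 : ℂ) 1).isPreconnected hqd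
      (fun x hx => hq0 x hx) hw hz₀
    simp only [h0, zero_div] at this
    exact (div_eq_zero_iff.1 this).resolve_right (hk0 w hw)
  have hdz : deriv h z = 0 := by
    have : h =ᶠ[𝓝 z] fun _ => 0 := by
      filter_upwards [isOpen_ball.mem_nhds hz] with w hw using hconst w hw
    rw [this.deriv_eq, deriv_const]
  have := hhe z hz
  rw [hconst z hz, hdz, eq_div_iff (mul_ne_zero (hneφ z hz) (hne z hz))] at this
  linear_combination (-1 / 2) * this

/-! ### The class and its Schwarz functions -/

/-- The constant `(1 - β) e^{-iγ} cos γ`. -/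
noncomputable def scale (γ β : ℝ) : ℂ :=
  (1 - (β : ℂ)) * Complex.exp (-Complex.I * (γ : ℂ)) * (Real.cos γ : ℂ)

theorem cos_pos_of_abs_lt {γ : ℝ} (hγ : |γ| < Real.pi / 2) : 0 < Real.cos γ :=
  Real.cos_pos_of_mem_Ioo ⟨(abs_lt.1 hγ).1, (abs_lt.1 hγ).2⟩

theorem scale_ne_zero {γ β : ℝ} (hγ : |γ| < Real.pi / 2) (hβ : β < 1) : scale γ β ≠ 0 := by
  refine mul_ne_zero (mul_ne_zero ?_ (Complex.exp_ne_zero _)) ?_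
  · exact_mod_cast (sub_pos.2 hβ).ne'
  · exact_mod_cast (cos_pos_of_abs_lt hγ).ne'

/-- The factor e^{iγ} cancels the rotation in `scale`, so the real part is cos γ + (1-β) cos γ · Re
x, with a positive coefficient on Re x. This removes γ and β from the problem. -/
theorem lt_re_exp_mul_iff {γ β : ℝ} (hγ : |γ| < Real.pi / 2) (hβ : β < 1) (x : ℂ) :
    β * Real.cos γ < (Complex.exp (Complex.I * (γ : ℂ)) * (1 + scale γ β * x)).re ↔
      -1 < x.re := by
  have hE : Complex.exp (Complex.I * (γ : ℂ)) * Complex.exp (-Complex.I * (γ : ℂ)) = 1 := by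
    rw [← Complex.exp_add]; simp
  have h1 : Complex.exp (Complex.I * (γ : ℂ)) * (1 + scale γ β * x)
      = Complex.exp ((γ : ℂ) * Complex.I) + (((1 - β) * Real.cos γ : ℝ) : ℂ) * x := by
    rw [mul_comm (γ : ℂ), scale]
    push_cast
    linear_combination ((1 - (β : ℂ)) * Complex.cos γ * x) * hE
  have hpos : 0 < (1 - β) * Real.cos γ := mul_pos (sub_pos.2 hβ) (cos_pos_of_abs_lt hγ)
  rw [h1, Complex.add_re, Complex.exp_ofReal_mul_I_re, Complex.re_ofReal_mul]
  constructor
  · intro h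
    by_contra hx
    nlinarith [mul_le_mul_of_nonneg_left (not_lt.1 hx) hpos.le]
  · intro h
    nlinarith [mul_lt_mul_of_pos_left h hpos]

theorem mem_classP_zero_iff {γ β : ℝ} (hγ : |γ| < Real.pi / 2) (hβ : β < 1) {P : ℂ → ℂ} :
    P ∈ classP γ β 0 ↔ DifferentiableOn ℂ P (ball 0 1) ∧ P 0 = 1 ∧ deriv P 0 = 0 ∧
      ∀ z ∈ ball (0 : ℂ) 1, -1 < ((P z - 1) / scale γ β).re := by
  have h : ∀ z, β * Real.cos γ < (Complex.exp (Complex.I * (γ : ℂ)) * P z).re ↔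
      -1 < ((P z - 1) / scale γ β).re := fun z => by
    rw [← lt_re_exp_mul_iff hγ hβ, mul_div_cancel₀ _ (scale_ne_zero hγ hβ), add_sub_cancel]
  simp only [classP, classPGen, mem_ofPred_eq, h, mul_zero, zero_mul]
  tauto

theorem one_add_scale_mul_mem_classP {γ β : ℝ} (hγ : |γ| < Real.pi / 2) (hβ : β < 1)
    {s : ℂ → ℂ} (hs : DifferentiableOn ℂ s (ball 0 1))
    (hre : ∀ z ∈ ball (0 : ℂ) 1, -1 < (z ^ 2 * s z).re) :
    (fun z => 1 + scale γ β * (z ^ 2 * s z)) ∈ classP γ β 0 := by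
  refine (mem_classP_zero_iff hγ hβ).2 ⟨by fun_prop, by simp, ?_, fun z hz => ?_⟩
  · have h1 := (hs.differentiableAt (ball_mem_nhds (0 : ℂ) one_pos)).hasDerivAt
    have h2 := ((((hasDerivAt_id (0 : ℂ)).pow 2).mul h1).const_mul (scale γ β)).const_add 1
    simpa using h2.deriv
  · rw [add_sub_cancel_left, mul_div_cancel_left₀ _ (scale_ne_zero hγ hβ)]
    exact hre z hz

theorem extremalH_zero (γ β : ℝ) (a z : ℂ) :
    extremalH γ β a 0 z = 1 + scale γ β * (z ^ 2 * (2 * a / (1 - a * z ^ 2))) := by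
  simp only [extremalH, delta, scale, map_zero, zero_mul, add_zero, div_one]
  rw [show a * z * z = a * z ^ 2 by ring]
  ring

theorem extremalH_mem_classP {γ β : ℝ} (hγ : |γ| < Real.pi / 2) (hβ : β < 1) {a : ℂ}
    (ha : ‖a‖ ≤ 1) : extremalH γ β a 0 ∈ classP γ β 0 := by
  rw [show extremalH γ β a 0 = _ from funext (extremalH_zero γ β a)]
  refine one_add_scale_mul_mem_classP hγ hβ ?_ fun z hz => ?_
  · exact DifferentiableOn.div (by fun_prop) (by fun_prop) fun z hz =>
      one_sub_ne_zero (norm_mul_sq_lt_one ha hz)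
  · have hu := norm_mul_sq_lt_one ha hz
    have hne := one_sub_ne_zero hu
    have h := normSq_lt_one hu
    have e : z ^ 2 * (2 * a / (1 - a * z ^ 2)) = (1 + a * z ^ 2) / (1 - a * z ^ 2) - 1 := by
      rw [div_sub_one hne]
      ring
    have hpos : 0 < ((1 + a * z ^ 2) / (1 - a * z ^ 2)).re := by
      apply re_div_pos_of
      simp only [Complex.add_re, Complex.sub_re, Complex.add_im, Complex.sub_im, Complex.one_re,
        Complex.one_im]
      linarith
    rw [e, Complex.sub_re, Complex.one_re]
    linarith

/-- The Schwarz function attached to a member of the class, divided by `a z²`. -/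
theorem exists_schwarz_of_mem_classP {γ β : ℝ} (hγ : |γ| < Real.pi / 2) (hβ : β < 1) {P : ℂ → ℂ}
    (hP : P ∈ classP γ β 0) {a : ℂ} (ha : ‖a‖ = 1) :
    ∃ φ : ℂ → ℂ, DifferentiableOn ℂ φ (ball 0 1) ∧ (∀ z ∈ ball (0 : ℂ) 1, ‖φ z‖ ≤ 1) ∧
      ∀ z ∈ ball (0 : ℂ) 1,
        P z = 1 + scale γ β * (2 * (a * z ^ 2 * φ z) / (1 - a * z ^ 2 * φ z)) := by
  obtain ⟨hd, h0, hd0, hre⟩ := (mem_classP_zero_iff hγ hβ).1 hP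
  have hc := scale_ne_zero hγ hβ
  have hn := ball_mem_nhds (0 : ℂ) one_pos
  have ha0 : a ≠ 0 := norm_ne_zero_iff.1 (by rw [ha]; exact one_ne_zero)
  set s : ℂ → ℂ := fun z => (P z - 1) / scale γ β with hs
  have hsd : DifferentiableOn ℂ s (ball 0 1) := by fun_prop
  have hs0 : s 0 = 0 := by simp [hs, h0]
  have hs' : HasDerivAt s 0 0 := by
    have := ((hd.differentiableAt hn).hasDerivAt.sub_const 1).div_const (scale γ β)
    simpa [hd0] using this
  have hs2 : ∀ z ∈ ball (0 : ℂ) 1, s z + 2 ≠ 0 := fun z hz h => by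
    have := hre z hz
    rw [show (P z - 1) / scale γ β = -2 from eq_neg_of_add_eq_zero_left h] at this
    norm_num at this
  -- Cayley transform of 1 + s, whose real part is positive.
  set ω : ℂ → ℂ := fun z => s z / (s z + 2) with hω
  have hωd : DifferentiableOn ℂ ω (ball 0 1) := hsd.div (by fun_prop) hs2
  have hω0 : ω 0 = 0 := by simp [hω, hs0]
  have hω' : deriv ω 0 = 0 := by
    have := hs'.fun_div (hs'.add_const 2) (by simp [hs0])
    simpa [hs0] using this.deriv
  have hω1 : ∀ z ∈ ball (0 : ℂ) 1, ‖ω z‖ < 1 := fun z hz => by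
    have h1 : -1 < (s z).re := hre z hz
    rw [hω, norm_div, div_lt_one (norm_pos_iff.2 (hs2 z hz)), ← sq_lt_sq₀ (norm_nonneg _)
      (norm_nonneg _), ← Complex.normSq_eq_norm_sq, ← Complex.normSq_eq_norm_sq,
      Complex.normSq_apply, Complex.normSq_apply]
    simp
    nlinarith
  have hinv : ∀ z ∈ ball (0 : ℂ) 1, P z = 1 + scale γ β * (2 * ω z / (1 - ω z)) := fun z hz => by
    have h1 := one_sub_ne_zero (hω1 z hz)
    have h2 := hs2 z hz
    have h3 : s z = 2 * ω z / (1 - ω z) := by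
      rw [eq_div_iff h1, hω]
      field_simp
      ring
    rw [← h3, hs, mul_div_cancel₀ _ hc]
    ring
  have e₁ : ∀ z, ω z = z * dslope ω 0 z := fun z => by
    simpa [hω0] using (sub_smul_dslope ω 0 z).symm
  have hω₁d : DifferentiableOn ℂ (dslope ω 0) (ball 0 1) :=
    (Complex.differentiableOn_dslope hn).2 hωd
  have hω₁0 : dslope ω 0 0 = 0 := by rw [dslope_same, hω']
  have e₂ : ∀ z, dslope ω 0 z = z * dslope (dslope ω 0) 0 z := fun z => by
    simpa [hω'] using (sub_smul_dslope (dslope ω 0) 0 z).symm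
  -- The Schwarz lemma applies twice, because ω and ω' both vanish at 0.
  have hω₁1 : ∀ z ∈ ball (0 : ℂ) 1, ‖dslope ω 0 z‖ ≤ 1 := fun z hz => by
    have := Complex.norm_dslope_le_div_of_mapsTo_ball (R₂ := 1) hωd (fun w hw => by
      rw [hω0, mem_closedBall_zero_iff]; exact (hω1 w hw).le) hz
    simpa using this
  have hω₂1 : ∀ z ∈ ball (0 : ℂ) 1, ‖dslope (dslope ω 0) 0 z‖ ≤ 1 := fun z hz => by
    have := Complex.norm_dslope_le_div_of_mapsTo_ball (R₂ := 1) hω₁d (fun w hw => by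
      rw [hω₁0, mem_closedBall_zero_iff]; exact hω₁1 w hw) hz
    simpa using this
  refine ⟨fun z => a⁻¹ * dslope (dslope ω 0) 0 z, ?_, fun z hz => ?_, fun z hz => ?_⟩
  · exact ((Complex.differentiableOn_dslope hn).2 hω₁d).const_mul _
  · rw [norm_mul, norm_inv, ha, inv_one, one_mul]
    exact hω₂1 z hz
  · rw [hinv z hz, show a * z ^ 2 * (a⁻¹ * dslope (dslope ω 0) 0 z) = ω z by
      rw [e₁ z, e₂ z]; field_simp]

/-! ### Support lines of the region -/

/-- At every point of the extremal curve the region has a support line, which touches the region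
for the extremal function only. -/
theorem exists_support {γ β : ℝ} (hγ : |γ| < Real.pi / 2) (hβ : β < 1) {z₀ : ℂ}
    (hz₀ : z₀ ∈ ball (0 : ℂ) 1) (hz₀' : z₀ ≠ 0) {a : ℂ} (ha : ‖a‖ = 1) :
    ∃ m : ℂ, m ≠ 0 ∧ ∀ P ∈ classP γ β 0,
      ((primitiveAt P z₀ - primitiveAt (extremalH γ β a 0) z₀) / m).re ≤ 0 ∧
      (primitiveAt P z₀ = primitiveAt (extremalH γ β a 0) z₀ →
        EqOn P (extremalH γ β a 0) (ball 0 1)) := by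
  obtain ⟨k, hk, hke, hkpos⟩ := exists_starlike ha.le
  have hk0 : k z₀ ≠ 0 := fun h0 => by
    have := hkpos z₀ hz₀
    simp [h0] at this
  have hc := scale_ne_zero hγ hβ
  have ha0 : a ≠ 0 := norm_ne_zero_iff.1 (by rw [ha]; exact one_ne_zero)
  -- This m makes the normalised difference of the integrals equal to h(z₀)/k(z₀).
  refine ⟨scale γ β * a * z₀ ^ 3 * k z₀, by positivity, fun P hP => ?_⟩
  obtain ⟨φ, hφ, hφ1, hPφ⟩ := exists_schwarz_of_mem_classP hγ hβ hP ha
  have hu := fun z (hz : z ∈ ball (0 : ℂ) 1) => norm_mul_sq_lt_one ha.le hz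
  have hne : ∀ z ∈ ball (0 : ℂ) 1, 1 - a * z ^ 2 ≠ 0 := fun z hz => one_sub_ne_zero (hu z hz)
  have hneφ : ∀ z ∈ ball (0 : ℂ) 1, 1 - a * z ^ 2 * φ z ≠ 0 := fun z hz =>
    one_sub_ne_zero (by
      rw [norm_mul]
      exact (mul_le_of_le_one_right (norm_nonneg _) (hφ1 z hz)).trans_lt (hu z hz))
  set f : ℂ → ℂ := fun z => 2 * (φ z - 1) / ((1 - a * z ^ 2 * φ z) * (1 - a * z ^ 2)) with hf
  have hfd : DifferentiableOn ℂ f (ball 0 1) :=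
    DifferentiableOn.div (by fun_prop) (by fun_prop) fun z hz =>
      mul_ne_zero (hneφ z hz) (hne z hz)
  obtain ⟨h, hh, hhe⟩ := exists_three_mul_add_mul_deriv_eq hfd
  have hPf : EqOn P (fun z => extremalH γ β a 0 z + scale γ β * a * (z ^ 2 * f z)) (ball 0 1) := by
    intro z hz
    have n1 := hne z hz
    have n2 := hneφ z hz
    simp only [hPφ z hz, extremalH_zero, hf]
    field_simp
    ring
  have hHc := ((mem_classP_zero_iff hγ hβ).1 (extremalH_mem_classP hγ hβ ha.le)).1.continuousOn
  have hfc := hfd.continuousOn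
  have hdiff : primitiveAt P z₀ =
      primitiveAt (extremalH γ β a 0) z₀ + scale γ β * a * (z₀ ^ 3 * h z₀) := by
    rw [primitiveAt_congr hPf hz₀, primitiveAt_add hHc (by fun_prop) hz₀, primitiveAt_const_mul,
      primitiveAt_sq_mul hfd hh hhe hz₀]
  obtain ⟨h1, h2⟩ := re_div_nonpos_of_starlike ha.le hk hke hkpos hφ1 hh hhe z₀ hz₀
  constructor
  · rw [hdiff, show (primitiveAt (extremalH γ β a 0) z₀ + scale γ β * a * (z₀ ^ 3 * h z₀)
      - primitiveAt (extremalH γ β a 0) z₀) / (scale γ β * a * z₀ ^ 3 * k z₀) = h z₀ / k z₀ by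
      field_simp; ring]
    exact h1
  · intro heq
    rw [hdiff, add_eq_left] at heq
    have hz : h z₀ = 0 := by simpa [hc, ha0, hz₀'] using heq
    intro z hz'
    rw [hPf hz']
    simp [hf, h2 hz z hz']

/-! ### Convexity, interior and frontier -/

theorem convex_regionV {γ β : ℝ} (hγ : |γ| < Real.pi / 2) (hβ : β < 1) {z₀ : ℂ}
    (hz₀ : z₀ ∈ ball (0 : ℂ) 1) : Convex ℝ (regionV γ β z₀ 0) := by
  rintro _ ⟨P, hP, rfl⟩ _ ⟨Q, hQ, rfl⟩ s t hs ht hst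
  obtain ⟨hPd, hP0, hPd0, hPre⟩ := (mem_classP_zero_iff hγ hβ).1 hP
  obtain ⟨hQd, hQ0, hQd0, hQre⟩ := (mem_classP_zero_iff hγ hβ).1 hQ
  have hn := ball_mem_nhds (0 : ℂ) one_pos
  have hstc : (s : ℂ) + t = 1 := by exact_mod_cast hst
  have hPc := hPd.continuousOn
  have hQc := hQd.continuousOn
  refine ⟨fun z => s * P z + t * Q z, (mem_classP_zero_iff hγ hβ).2
    ⟨by fun_prop, by simp [hP0, hQ0, hstc], ?_, fun z hz => ?_⟩, ?_⟩
  · have := ((hPd.differentiableAt hn).hasDerivAt.const_mul (s : ℂ)).add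
      ((hQd.differentiableAt hn).hasDerivAt.const_mul (t : ℂ))
    simp only [hPd0, hQd0, mul_zero, add_zero] at this
    exact this.deriv
  · have e : (s * P z + t * Q z - 1) / scale γ β
        = s * ((P z - 1) / scale γ β) + t * ((Q z - 1) / scale γ β) := by
      linear_combination hstc / scale γ β
    rw [e, Complex.add_re, Complex.re_ofReal_mul, Complex.re_ofReal_mul]
    have h1 := hPre z hz
    have h2 := hQre z hz
    rcases hs.eq_or_lt with h | h
    · have : t = 1 := by linarith
      subst this
      rw [← h]
      linarith
    · have := mul_lt_mul_of_pos_left h1 h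
      have := mul_le_mul_of_nonneg_left h2.le ht
      linarith
  · rw [primitiveAt_add (by fun_prop) (by fun_prop) hz₀, primitiveAt_const_mul,
      primitiveAt_const_mul]
    simp

/-- The functions 1 + c b z² with c = `scale γ β` and |b| < 1 lie in the class, and their integrals
z₀ + c b z₀³/3 fill a disk about z₀. -/
theorem regionV_mem_nhds {γ β : ℝ} (hγ : |γ| < Real.pi / 2) (hβ : β < 1) {z₀ : ℂ}
    (hz₀ : z₀ ∈ ball (0 : ℂ) 1) (hz₀' : z₀ ≠ 0) : regionV γ β z₀ 0 ∈ 𝓝 z₀ := by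
  have hc := scale_ne_zero hγ hβ
  have hm : scale γ β * (z₀ ^ 3 / 3) ≠ 0 := by simp [hc, hz₀']
  refine mem_of_superset (ball_mem_nhds z₀ (norm_pos_iff.2 hm)) fun w hw => ?_
  set b := (w - z₀) / (scale γ β * (z₀ ^ 3 / 3)) with hb
  have hb1 : ‖b‖ < 1 := by
    rw [hb, norm_div, div_lt_one (norm_pos_iff.2 hm), ← dist_eq_norm]
    exact hw
  refine ⟨_, one_add_scale_mul_mem_classP hγ hβ (s := fun _ => b) (by fun_prop)
    fun z hz => ?_, ?_⟩
  · have h1 := norm_mul_sq_lt_one hb1.le hz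
    have h2 := (Complex.abs_re_le_norm _).trans_lt h1
    rw [mul_comm]
    exact (abs_lt.1 h2).1
  · rw [primitiveAt_eq_sub (F := fun z => z + scale γ β * (z ^ 3 / 3 * b)) (by fun_prop)
      (fun z _ => ?_) hz₀]
    · have : scale γ β * (z₀ ^ 3 / 3 * b) = w - z₀ := by
        rw [hb, ← mul_assoc, mul_div_cancel₀ _ hm]
      simp [this]
    · have := (hasDerivAt_id z).add
        (((((hasDerivAt_id z).pow 3).div_const 3).mul_const b).const_mul (scale γ β))
      refine this.congr_deriv ?_
      simp

/-- A ray from an interior point of a convex set meets the frontier at most once. -/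
theorem eq_of_mem_frontier_of_ray {W : Set ℂ} (hW : Convex ℝ W) {x v : ℂ}
    (hx : x ∈ interior W) {r s : ℝ} (hr : 0 < r) (hs : 0 < s) (h₁ : x + r * v ∈ frontier W)
    (h₂ : x + s * v ∈ frontier W) : r = s := by
  have key : ∀ {r s : ℝ}, 0 < r → 0 < s → x + r * v ∈ frontier W → x + s * v ∈ frontier W →
      ¬ r < s := by
    intro r s hr hs h₁ h₂ hlt
    have h3 := hW.add_smul_sub_mem_interior' h₂.1 hx (t := 1 - r / s)
      ⟨sub_pos.2 ((div_lt_one hs).2 hlt), by have := div_pos hr hs; linarith⟩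
    have e : x + s * v + (1 - r / s) • (x - (x + s * v)) = x + r * v := by
      have : (s : ℂ) ≠ 0 := by exact_mod_cast hs.ne'
      rw [Complex.real_smul]
      push_cast
      field_simp
      ring
    rw [e] at h3
    exact h₁.2 h3
  exact le_antisymm (not_lt.1 (key hs hr h₂ h₁)) (not_lt.1 (key hr hs h₁ h₂))

/-- From an interior point a small step in the direction m would stay in the region and violate the
support inequality. -/
theorem primitiveAt_extremalH_mem_frontier {γ β : ℝ} (hγ : |γ| < Real.pi / 2) (hβ : β < 1)
    {z₀ : ℂ} (hz₀ : z₀ ∈ ball (0 : ℂ) 1) (hz₀' : z₀ ≠ 0) {a : ℂ} (ha : ‖a‖ = 1) :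
    primitiveAt (extremalH γ β a 0) z₀ ∈ frontier (regionV γ β z₀ 0) := by
  obtain ⟨m, hm, hsup⟩ := exists_support hγ hβ hz₀ hz₀' ha
  set w := primitiveAt (extremalH γ β a 0) z₀ with hw
  refine ⟨subset_closure ⟨_, extremalH_mem_classP hγ hβ ha.le, rfl⟩, fun hint => ?_⟩
  have ht : Tendsto (fun t : ℝ => w + t * m) (𝓝[>] 0) (𝓝 w) := by
    have : Continuous fun t : ℝ => w + t * m := by fun_prop
    simpa using (this.tendsto 0).mono_left nhdsWithin_le_nhds
  obtain ⟨t, ht1, ht0⟩ := ((ht.eventually (mem_interior_iff_mem_nhds.1 hint)).and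
    self_mem_nhdsWithin).exists
  obtain ⟨P, hP, hPt⟩ := ht1
  have h := (hsup P hP).1
  rw [hPt, add_sub_cancel_left, mul_div_cancel_right₀ _ hm, Complex.ofReal_re] at h
  exact absurd h (not_le.2 ht0)

/-! ### The curve meets every ray from z₀ -/

/-- `∫₀¹ t² / (1 - t² u) dt`. -/
noncomputable def kernelMean (u : ℂ) : ℂ :=
  ∫ t in (0 : ℝ)..1, (t : ℂ) ^ 2 / (1 - (t : ℂ) ^ 2 * u)

theorem norm_ofReal_sq_mul_le {u : ℂ} {t : ℝ} (ht : t ∈ Icc (0 : ℝ) 1) :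
    ‖(t : ℂ) ^ 2 * u‖ ≤ ‖u‖ := by
  rw [norm_mul, norm_pow, Complex.norm_real, Real.norm_eq_abs, abs_of_nonneg ht.1]
  exact mul_le_of_le_one_left (norm_nonneg _) (pow_le_one₀ ht.1 ht.2)

theorem continuousOn_kernel {u : ℂ} (hu : ‖u‖ < 1) :
    ContinuousOn (fun t : ℝ => (t : ℂ) ^ 2 / (1 - (t : ℂ) ^ 2 * u)) (Icc 0 1) :=
  ContinuousOn.div (by fun_prop) (by fun_prop) fun _ ht =>
    one_sub_ne_zero ((norm_ofReal_sq_mul_le ht).trans_lt hu)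

theorem re_kernelMean_pos {u : ℂ} (hu : ‖u‖ < 1) : 0 < (kernelMean u).re := by
  have hc := continuousOn_kernel hu
  rw [← uIcc_of_le zero_le_one] at hc
  have e : (kernelMean u).re
      = ∫ t in (0 : ℝ)..1, ((t : ℂ) ^ 2 / (1 - (t : ℂ) ^ 2 * u)).re :=
    (Complex.reCLM.intervalIntegral_comp_comm hc.intervalIntegrable).symm
  rw [e]
  refine intervalIntegral.intervalIntegral_pos_of_pos_on
    (Complex.continuous_re.comp_continuousOn hc).intervalIntegrable (fun t ht => ?_) one_pos
  have hu' := (norm_ofReal_sq_mul_le (u := u) ⟨ht.1.le, ht.2.le⟩).trans_lt hu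
  have h1 : ((t : ℂ) ^ 2 * u).re < 1 :=
    (le_abs_self _).trans_lt ((Complex.abs_re_le_norm _).trans_lt hu')
  have h2 : 0 < t ^ 2 := pow_pos ht.1 2
  apply re_div_pos_of
  rw [← Complex.ofReal_pow] at h1 ⊢
  rw [Complex.ofReal_re, Complex.ofReal_im, Complex.sub_re, Complex.one_re]
  nlinarith

theorem continuous_kernelMean_exp {v : ℂ} (hv : ‖v‖ < 1) :
    Continuous fun θ : ℝ => kernelMean (Complex.exp (Complex.I * θ) * v) := by
  have hn : ∀ θ : ℝ, ‖Complex.exp (Complex.I * θ) * v‖ = ‖v‖ := fun θ => by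
    rw [norm_mul, mul_comm Complex.I, Complex.norm_exp_ofReal_mul_I, one_mul]
  have hlt : ∀ θ : ℝ, ∀ t ∈ Icc (0 : ℝ) 1,
      ‖(t : ℂ) ^ 2 * (Complex.exp (Complex.I * θ) * v)‖ ≤ ‖v‖ := fun θ t ht =>
    (norm_ofReal_sq_mul_le ht).trans_eq (hn θ)
  have hsub : uIoc (0 : ℝ) 1 ⊆ Icc 0 1 := by
    rw [uIoc_of_le zero_le_one]; exact Ioc_subset_Icc_self
  refine intervalIntegral.continuous_of_dominated_interval (bound := fun _ => 1 / (1 - ‖v‖))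
    (fun θ => ?_) (fun θ => ?_) intervalIntegrable_const ?_
  · exact ((continuousOn_kernel ((hn θ).trans_lt hv)).mono hsub).aestronglyMeasurable
      measurableSet_uIoc
  · refine Eventually.of_forall fun t ht => ?_
    have ht' := hsub ht
    have h1 := hlt θ t ht'
    have h2 : 1 - ‖v‖ ≤ ‖1 - (t : ℂ) ^ 2 * (Complex.exp (Complex.I * θ) * v)‖ := by
      have := norm_sub_norm_le (1 : ℂ) ((t : ℂ) ^ 2 * (Complex.exp (Complex.I * θ) * v))
      rw [norm_one] at this
      linarith
    rw [norm_div]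
    refine div_le_div₀ zero_le_one ?_ (sub_pos.2 hv) h2
    rw [norm_pow, Complex.norm_real, Real.norm_eq_abs, abs_of_nonneg ht'.1]
    exact pow_le_one₀ ht'.1 ht'.2
  · refine Eventually.of_forall fun t ht => ?_
    exact Continuous.div (by fun_prop) (by fun_prop) fun θ =>
      one_sub_ne_zero ((hlt θ t (hsub ht)).trans_lt hv)

theorem primitiveAt_extremalH (γ β : ℝ) {a z₀ : ℂ} (ha : ‖a‖ ≤ 1)
    (hz₀ : z₀ ∈ ball (0 : ℂ) 1) :
    primitiveAt (extremalH γ β a 0) z₀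
      = z₀ + 2 * scale γ β * z₀ ^ 3 * (a * kernelMean (a * z₀ ^ 2)) := by
  have hc := continuousOn_kernel (norm_mul_sq_lt_one ha hz₀)
  rw [← uIcc_of_le zero_le_one] at hc
  have e : ∀ t : ℝ, extremalH γ β a 0 (t * z₀) * z₀ = z₀ + 2 * scale γ β * z₀ ^ 3 * a *
      ((t : ℂ) ^ 2 / (1 - (t : ℂ) ^ 2 * (a * z₀ ^ 2))) := fun t => by
    rw [extremalH_zero, show a * ((t : ℂ) * z₀) ^ 2 = (t : ℂ) ^ 2 * (a * z₀ ^ 2) by ring]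
    ring
  simp only [primitiveAt, e]
  rw [intervalIntegral.integral_add (by simp) (hc.intervalIntegrable.const_mul _),
    intervalIntegral.integral_const_mul]
  simp [kernelMean, mul_assoc]

/-- The curve `θ ↦ e^{iθ} kernelMean (e^{iθ} v)` meets every ray from the origin. -/
theorem exists_mul_kernelMean_eq {v d : ℂ} (hv : ‖v‖ < 1) (hd : d ≠ 0) :
    ∃ a : ℂ, ‖a‖ = 1 ∧ ∃ r : ℝ, 0 < r ∧ a * kernelMean (a * v) = r * d := by
  have hn : ∀ θ : ℝ, ‖Complex.exp (Complex.I * θ)‖ = 1 := fun θ => by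
    rw [mul_comm, Complex.norm_exp_ofReal_mul_I]
  have hpos : ∀ θ : ℝ, 0 < (kernelMean (Complex.exp (Complex.I * θ) * v)).re := fun θ =>
    re_kernelMean_pos (by rwa [norm_mul, hn, one_mul])
  -- This is a continuous argument along the curve: Re K > 0 keeps K off the branch cut. As |arg K|
  -- ≤ π, its values at θ = arg d ∓ π bracket arg d, and the intermediate value theorem applies.
  have hg : Continuous fun θ : ℝ =>
      θ + (kernelMean (Complex.exp (Complex.I * θ) * v)).arg :=
    continuous_id.add (continuous_iff_continuousAt.2 fun θ =>
      (Complex.continuousAt_arg (Or.inl (hpos θ))).comp_of_eq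
        (continuous_kernelMean_exp hv).continuousAt rfl)
  obtain ⟨θ, hθ⟩ := mem_range_of_exists_le_of_exists_ge hg (c := d.arg)
    ⟨d.arg - Real.pi, le_of_le_of_eq (add_le_add_right (Complex.arg_le_pi _) _) (by ring)⟩
    ⟨d.arg + Real.pi, le_of_eq_of_le (by ring)
      (add_le_add_right (Complex.neg_pi_lt_arg _).le _)⟩
  set K := kernelMean (Complex.exp (Complex.I * θ) * v) with hK
  have hθ' : θ + K.arg = d.arg := hθ
  have hK0 : K ≠ 0 := fun h => by
    have := hpos θ
    rw [← hK, h] at this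
    simp at this
  refine ⟨Complex.exp (Complex.I * θ), hn θ, ‖K‖ / ‖d‖, by positivity, ?_⟩
  have hd' : (‖d‖ : ℂ) ≠ 0 := by exact_mod_cast norm_ne_zero_iff.2 hd
  rw [← hK]
  have h1 := Complex.norm_mul_exp_arg_mul_I K
  have h2 := Complex.norm_mul_exp_arg_mul_I d
  have h3 : Complex.exp (d.arg * Complex.I)
      = Complex.exp (Complex.I * θ) * Complex.exp (K.arg * Complex.I) := by
    rw [← Complex.exp_add, ← hθ']
    push_cast
    ring_nf
  rw [Complex.ofReal_div, div_mul_eq_mul_div, eq_div_iff hd']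
  linear_combination (-(‖d‖ : ℂ) * Complex.exp (Complex.I * θ)) * h1 + (‖K‖ : ℂ) * h2
    - ((‖K‖ : ℂ) * ‖d‖) * h3

/-- The ray from z₀ through w contains a curve point, which is also on the frontier; a ray meets the
frontier only once, so the two coincide. -/
theorem exists_primitiveAt_extremalH_eq {γ β : ℝ} (hγ : |γ| < Real.pi / 2) (hβ : β < 1)
    {z₀ : ℂ} (hz₀ : z₀ ∈ ball (0 : ℂ) 1) (hz₀' : z₀ ≠ 0) {w : ℂ}
    (hw : w ∈ frontier (regionV γ β z₀ 0)) :
    ∃ a : ℂ, ‖a‖ = 1 ∧ primitiveAt (extremalH γ β a 0) z₀ = w := by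
  have hc := scale_ne_zero hγ hβ
  have hint : z₀ ∈ interior (regionV γ β z₀ 0) :=
    mem_interior_iff_mem_nhds.2 (regionV_mem_nhds hγ hβ hz₀ hz₀')
  have hne : w - z₀ ≠ 0 := fun h => hw.2 (by rwa [sub_eq_zero.1 h])
  have hM : 2 * scale γ β * z₀ ^ 3 ≠ 0 := by simp [hc, hz₀']
  have hv : ‖z₀ ^ 2‖ < 1 := by
    simpa using norm_mul_sq_lt_one (a := 1) (by simp) hz₀
  obtain ⟨a, ha, r, hr, har⟩ := exists_mul_kernelMean_eq hv (div_ne_zero hne hM)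
  have e : primitiveAt (extremalH γ β a 0) z₀ = z₀ + r * (w - z₀) := by
    rw [primitiveAt_extremalH γ β ha.le hz₀, har]
    field_simp
  have hf := primitiveAt_extremalH_mem_frontier hγ hβ hz₀ hz₀' ha
  rw [e] at hf
  have hr1 : r = 1 := eq_of_mem_frontier_of_ray (convex_regionV hγ hβ hz₀) hint hr one_pos
    hf (by simpa using hw)
  exact ⟨a, ha, by rw [e, hr1]; simp⟩

/-! ### Injectivity and the closed form -/

theorem extremalH_injective {γ β : ℝ} (hγ : |γ| < Real.pi / 2) (hβ : β < 1) {a b : ℂ}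
    (ha : ‖a‖ ≤ 1) (hb : ‖b‖ ≤ 1)
    (h : EqOn (extremalH γ β a 0) (extremalH γ β b 0) (ball 0 1)) : a = b := by
  have hz : (1 / 2 : ℂ) ∈ ball (0 : ℂ) 1 := by
    rw [mem_ball_zero_iff]; norm_num
  have h1 := h hz
  have n1 := one_sub_ne_zero (norm_mul_sq_lt_one ha hz)
  have n2 := one_sub_ne_zero (norm_mul_sq_lt_one hb hz)
  rw [extremalH_zero, extremalH_zero, add_right_inj, mul_right_inj' (scale_ne_zero hγ hβ),
    mul_right_inj' (by norm_num), div_eq_div_iff n1 n2] at h1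
  linear_combination h1 / 2

/-- A square root b of the parameter splits 1 - b²z² into (1-bz)(1+bz), and 2/(1-b²z²) is b⁻¹ times
the derivative of log((1+bz)/(1-bz)). The quotient has positive real part, so the principal branch
is differentiable there. -/
theorem primitiveAt_extremalH_sq (γ β : ℝ) {b z₀ : ℂ} (hb : ‖b‖ = 1)
    (hz₀ : z₀ ∈ ball (0 : ℂ) 1) :
    primitiveAt (extremalH γ β (b ^ 2) 0) z₀ = (1 - 2 * scale γ β) * z₀
      + scale γ β * b⁻¹ * Complex.log ((1 + b * z₀) / (1 - b * z₀)) := by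
  have hb0 : b ≠ 0 := norm_ne_zero_iff.1 (by rw [hb]; exact one_ne_zero)
  have hb2 : ‖b ^ 2‖ ≤ 1 := by simp [hb]
  have hlt : ∀ z ∈ ball (0 : ℂ) 1, ‖b * z‖ < 1 := fun z hz => by
    rwa [norm_mul, hb, one_mul, ← mem_ball_zero_iff]
  rw [primitiveAt_eq_sub (F := fun z => (1 - 2 * scale γ β) * z
      + scale γ β * b⁻¹ * Complex.log ((1 + b * z) / (1 - b * z))) ?_ (fun z hz => ?_) hz₀]
  · simp
  · rw [show extremalH γ β (b ^ 2) 0 = _ from funext (extremalH_zero γ β (b ^ 2))]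
    have : ContinuousOn (fun z : ℂ => 2 * b ^ 2 / (1 - b ^ 2 * z ^ 2)) (ball 0 1) :=
      ContinuousOn.div (by fun_prop) (by fun_prop) fun z hz =>
        one_sub_ne_zero (norm_mul_sq_lt_one hb2 hz)
    fun_prop
  · have hu := hlt z hz
    have n1 := one_sub_ne_zero hu
    have n2 : 1 + b * z ≠ 0 := by
      have := one_sub_ne_zero (u := -(b * z)) (by rwa [norm_neg])
      rwa [sub_neg_eq_add] at this
    have n3 := one_sub_ne_zero (norm_mul_sq_lt_one hb2 hz)
    have hsq := normSq_lt_one hu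
    have hre : 0 < ((1 + b * z) / (1 - b * z)).re := by
      apply re_div_pos_of
      simp only [Complex.add_re, Complex.sub_re, Complex.add_im, Complex.sub_im, Complex.one_re,
        Complex.one_im]
      linarith
    have d0 : HasDerivAt (fun z => b * z) b z := by
      simpa using (hasDerivAt_id z).const_mul b
    have d1 := (((d0.const_add 1).fun_div (d0.const_sub 1) n1).clog (Or.inl hre)).const_mul
      (scale γ β * b⁻¹)
    have d2 := ((hasDerivAt_id z).const_mul (1 - 2 * scale γ β)).add d1
    refine d2.congr_deriv ?_
    rw [extremalH_zero]
    have n4 : 1 - b ^ 2 * z ^ 2 = (1 - b * z) * (1 + b * z) := by ring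
    rw [n4]
    field_simp
    ring

end VariabilityRegion

theorem corollary5p3 (γ β : ℝ) (hγ : |γ| < Real.pi / 2) (hβ : β < 1)
    (z₀ : ℂ) (hz₀ : z₀ ∈ Metric.ball (0 : ℂ) 1) (hz₀_ne : z₀ ≠ 0) :
    -- the boundary of the region is the Jordan curve given by the extremal functions
    VariabilityRegion.IsJordanCurveGivenBy
      (fun θ : ℝ => VariabilityRegion.primitiveAt
        (VariabilityRegion.extremalH γ β (Complex.exp (Complex.I * (θ : ℂ))) 0) z₀)
      (frontier (VariabilityRegion.regionV γ β z₀ 0)) ∧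
    -- the closed form of the curve
    (∀ θ ∈ Set.Ioc (-Real.pi) Real.pi,
      VariabilityRegion.primitiveAt
          (VariabilityRegion.extremalH γ β (Complex.exp (Complex.I * (θ : ℂ))) 0) z₀ =
        (1 - 2 * (1 - (β : ℂ)) * Complex.exp (-Complex.I * (γ : ℂ)) * (Real.cos γ : ℂ)) * z₀
        + Complex.exp (-Complex.I * (γ : ℂ)) * (1 - (β : ℂ))
          * Complex.exp (-Complex.I * (θ : ℂ) / 2) * (Real.cos γ : ℂ)
          * Complex.log ((1 + Complex.exp (Complex.I * (θ : ℂ) / 2) * z₀)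
              / (1 - Complex.exp (Complex.I * (θ : ℂ) / 2) * z₀))) ∧
    -- each point of the curve is attained in the class by the extremal function, and only by it
    (∀ θ ∈ Set.Ioc (-Real.pi) Real.pi,
      VariabilityRegion.extremalH γ β (Complex.exp (Complex.I * (θ : ℂ))) 0
        ∈ VariabilityRegion.classP γ β 0 ∧
      ∀ P ∈ VariabilityRegion.classP γ β 0,
        VariabilityRegion.primitiveAt P z₀ =
          VariabilityRegion.primitiveAt
            (VariabilityRegion.extremalH γ β (Complex.exp (Complex.I * (θ : ℂ))) 0) z₀ →
        Set.EqOn P (VariabilityRegion.extremalH γ β (Complex.exp (Complex.I * (θ : ℂ))) 0)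
          (Metric.ball 0 1)) := by
  have hn : ∀ θ : ℝ, ‖Complex.exp (Complex.I * (θ : ℂ))‖ = 1 := fun θ => by
    rw [mul_comm, Complex.norm_exp_ofReal_mul_I]
  refine ⟨⟨?_, ?_, ?_, ?_⟩, fun θ _ => ?_, fun θ _ => ⟨?_, ?_⟩⟩
  · have hv : ‖z₀ ^ 2‖ < 1 := by
      simpa using VariabilityRegion.norm_mul_sq_lt_one (a := 1) (by simp) hz₀
    have hK := VariabilityRegion.continuous_kernelMean_exp hv
    simp only [fun θ : ℝ => VariabilityRegion.primitiveAt_extremalH γ β (hn θ).le hz₀]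
    exact Continuous.continuousOn (by fun_prop)
  · have : Complex.exp (Complex.I * ((-Real.pi : ℝ) : ℂ))
        = Complex.exp (Complex.I * (Real.pi : ℂ)) := by
      rw [mul_comm, mul_comm Complex.I, Complex.exp_pi_mul_I, Complex.ofReal_neg, neg_mul,
        Complex.exp_neg, Complex.exp_pi_mul_I]
      norm_num
    simp only [this]
  · intro θ₁ h₁ θ₂ h₂ heq
    -- Equal curve points force equal extremal functions by uniqueness at θ₂, hence equal parameters
    -- e^{iθ}.
    obtain ⟨m, -, hsup⟩ := VariabilityRegion.exists_support hγ hβ hz₀ hz₀_ne (hn θ₂)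
    have hexp := VariabilityRegion.extremalH_injective hγ hβ (hn θ₁).le (hn θ₂).le
      ((hsup _ (VariabilityRegion.extremalH_mem_classP hγ hβ (hn θ₁).le)).2 heq)
    have := Complex.exp_inj_of_neg_pi_lt_of_le_pi (by simpa using h₁.1) (by simpa using h₁.2)
      (by simpa using h₂.1) (by simpa using h₂.2) hexp
    exact_mod_cast mul_left_cancel₀ Complex.I_ne_zero this
  · refine Set.Subset.antisymm ?_ fun w hw => ?_
    · rintro _ ⟨θ, -, rfl⟩
      exact VariabilityRegion.primitiveAt_extremalH_mem_frontier hγ hβ hz₀ hz₀_ne (hn θ)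
    · obtain ⟨a, ha, haw⟩ :=
        VariabilityRegion.exists_primitiveAt_extremalH_eq hγ hβ hz₀ hz₀_ne hw
      refine ⟨a.arg, Complex.arg_mem_Ioc a, ?_⟩
      have : Complex.exp (Complex.I * (a.arg : ℂ)) = a := by
        have := Complex.norm_mul_exp_arg_mul_I a
        rwa [ha, Complex.ofReal_one, one_mul, mul_comm] at this
      simp only [this, haw]
  · have hb : ‖Complex.exp (Complex.I * (θ : ℂ) / 2)‖ = 1 := by
      have := hn (θ / 2)
      rwa [Complex.ofReal_div, Complex.ofReal_ofNat, ← mul_div_assoc] at this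
    have hsq : Complex.exp (Complex.I * (θ : ℂ)) = Complex.exp (Complex.I * (θ : ℂ) / 2) ^ 2 := by
      rw [← Complex.exp_nat_mul]
      congr 1
      push_cast
      ring
    have hinv : Complex.exp (-Complex.I * (θ : ℂ) / 2)
        = (Complex.exp (Complex.I * (θ : ℂ) / 2))⁻¹ := by
      rw [← Complex.exp_neg]
      congr 1
      ring
    rw [hsq, hinv, VariabilityRegion.primitiveAt_extremalH_sq γ β hb hz₀,
      VariabilityRegion.scale]
    ring
  · exact VariabilityRegion.extremalH_mem_classP hγ hβ (hn θ).le
  · obtain ⟨m, -, hsup⟩ := VariabilityRegion.exists_support hγ hβ hz₀ hz₀_ne (hn θ)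
    exact fun P hP => (hsup P hP).2
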